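/- For a group $G$ let $\Delta$ be the $G$-set of all cosets $gF$, where $F$ runs over the finite subgroups of $G$ and $g\in G$, with $G$ acting by left translation. A $\mathbb{Z}G$-module is called $\mathfrak{F}$-projective if it is a direct summand of $N\otimes_{\mathbb{Z}}\mathbb{Z}\Delta$ (with diagonal $G$-action) for some $\mathbb{Z}G$-module $N$. An exact sequence of $\mathbb{Z}G$-modules is called $\mathfrak{F}$-split if it becomes split over $\mathbb{Z}G$ after applying $-\otimes_{\mathbb{Z}}\mathbb{Z}\Delta$. The $\mathfrak{F}$-cohomological dimension $\mathfrak{F}\mathrm{cd}\,G\in\mathbb{N}\cup\{\infty\}$ is the $\mathfrak{F}$-projective dimension of the trivial $\mathbb{Z}G$-module $\mathbb{Z}$, that is, the least $n$ for which there is an $\mathfrak{F}$-split exact sequence $$0\to P_n\to\cdots\to P_1\to P_0\to\mathbb{Z}\to 0$$ of $\mathbb{Z}G$-modules with all $P_i$ $\mathfrak{F}$-projective (and $\infty$ if there is no such $n$). Let $H$ and $K$ be groups and let $n,m\ge 0$ be integers. If $\mathfrak{F}\mathrm{cd}\,H\le n$ and $\mathfrak{F}\mathrm{cd}\,K\le m$,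 then $\mathfrak{F}\mathrm{cd}(H\times K)\le n+m$. -/

import Mathlib

namespace FCoh

universe u

open CategoryTheory

/-- The standard `G`-set `Δ` of all cosets `gF` of all finite subgroups `F` of `G`, with `G` acting
by left translation. -/
abbrev FiniteCosets (G : Type u) [Group G] : Type u :=
  Σ F : {F : Subgroup G // Finite F}, G ⧸ F.1

/-- The permutation module `kΔ` on the `G`-set `Δ` of all cosets of finite subgroups. -/
noncomputable abbrev permRep (k : Type) [CommRing k] (G : Type u) [Group G] :
    Representation k G (MonoidAlgebra k (FiniteCosets G)) :=
  Representation.ofMulAction k G (FiniteCosets G)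

/-- The functor `A ↦ A ⊗ kΔ` (tensor product over `k`) on `kG`-modules, where `G` acts diagonally
on the tensor product. -/
noncomputable def tensorPerm (k : Type) [CommRing k] (G : Type u) [Group G] :
    Rep.{u} k G ⥤ Rep.{u} k G where
  obj A := Rep.of (A.ρ.tprod (permRep k G))
  map f := Rep.ofHom (f.hom.rTensor (permRep k G))
  map_id A := by
    rw [Rep.hom_id, Representation.IntertwiningMap.rTensor_id]
    rfl
  map_comp f g := by
    apply Rep.hom_ext
    apply Representation.IntertwiningMap.toLinearMap_injective
    exact LinearMap.rTensor_comp _ g.hom.toLinearMap f.hom.toLinearMap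

/-- The trivial `kG`-module `k` (with `k` lifted to the universe of `G`). -/
abbrev trivialRep (k : Type) [CommRing k] (G : Type u) [Group G] : Rep.{u} k G :=
  Rep.trivial k G (ULift.{u} k)

/-- A `kG`-module is `𝔉`-projective if it is a direct summand of `N ⊗ kΔ` for some `kG`-module
`N`. -/
def IsFProjective {k : Type} [CommRing k] {G : Type u} [Group G] (A : Rep.{u} k G) : Prop :=
  ∃ N : Rep.{u} k G, Nonempty (Retract A ((tensorPerm k G).obj N))

/-- An `𝔉`-projective resolution of `M` of length (at most) `n`: an exact sequence
`0 → P n → ⋯ → P 1 → P 0 → M → 0` of `kG`-modules with all `P i` being `𝔉`-projective, which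
becomes split over `kG` (has a `kG`-linear contracting homotopy) after tensoring with `kΔ`.
The sequence is extended by zero modules in degrees above `n`. -/
structure FProjResolution {k : Type} [CommRing k] {G : Type u} [Group G]
    (M : Rep.{u} k G) (n : ℕ) where
  /-- The modules of the resolution. -/
  P : ℕ → Rep.{u} k G
  /-- The differentials. -/
  d : ∀ i, P (i + 1) ⟶ P i
  /-- The augmentation. -/
  ε : P 0 ⟶ M
  isFProjective : ∀ i, IsFProjective (P i)
  isZero : ∀ i, n < i → Limits.IsZero (P i)
  surjective_ε : Function.Surjective ε.hom
  exact_zero : Function.Exact (d 0).hom ε.hom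
  exact_succ : ∀ i, Function.Exact (d (i + 1)).hom (d i).hom
  split : ∃ (t : (tensorPerm k G).obj M ⟶ (tensorPerm k G).obj (P 0))
    (s : ∀ i, (tensorPerm k G).obj (P i) ⟶ (tensorPerm k G).obj (P (i + 1))),
    t ≫ (tensorPerm k G).map ε = 𝟙 _ ∧
    (tensorPerm k G).map ε ≫ t + s 0 ≫ (tensorPerm k G).map (d 0) = 𝟙 _ ∧
    ∀ i, (tensorPerm k G).map (d i) ≫ s i + s (i + 1) ≫ (tensorPerm k G).map (d (i + 1)) = 𝟙 _

/-- The `𝔉`-projective dimension of a `kG`-module: the least length of an `𝔉`-projective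
resolution, and `⊤` if there is no resolution of finite length. -/
noncomputable def fpd {k : Type} [CommRing k] {G : Type u} [Group G] (M : Rep.{u} k G) : ℕ∞ :=
  ⨅ (n : ℕ) (_ : Nonempty (FProjResolution M n)), (n : ℕ∞)

/-- The `𝔉`-cohomological dimension of a group `G`: the `𝔉`-projective dimension of the trivial
`ℤG`-module `ℤ`. -/
noncomputable def fcd (G : Type u) [Group G] : ℕ∞ :=
  fpd (trivialRep ℤ G)

end FCoh

/-! The point is to trade splittings after tensoring with kΔ for data indexed by Δ. Composing a
`kG`-map `A ⊗ kΔ → B ⊗ kΔ` with the augmentation `B ⊗ kΔ → B` gives linear maps `σ x : A → B`, `x ∈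
Δ`, permuted by `G` under conjugation. Conversely such a family gives the map `a ⊗ x ↦ σ x a ⊗ x`.
Hence an 𝔉-split resolution is a complex with an equivariant family of `k`-linear contractions
indexed by Δ (`FProjResolution.exists_contraction`, `FProjResolution.nonempty_of_contraction`).
Likewise `A` is 𝔉-projective exactly when `A ⊗ kΔ → A` has a `kG`-section (`isFProjective_iff`).

Given resolutions `P` over `H` and `Q` over `K`, the total complex of `P ⊗ Q` resolves the outer
tensor product and vanishes above degree `n + m`. Two facts about Δ make it an 𝔉-projective
resolution over `H × K`. Projections of finite subgroups are finite, so Δ of `H × K` maps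
equivariantly to Δ of `H` and of `K`. Contractions of `P` and `Q` can be pulled back along these
maps and tensored by an explicit formula (`totalContraction`), which preserves equivariance.
Products of finite subgroups are finite, so a pair of cosets gives a coset in `H × K`. This turns
sections for `P i` and `Q j` into one for `P i ⊗ Q j` (`isFProjective_total`). -/

namespace FCoh

universe u v w

open CategoryTheory TensorProduct

/-! ### Morphisms after tensoring with kΔ and equivariant families; 𝔉-projectivity -/

section Families

variable {k : Type} [CommRing k] {G : Type u} [Group G]

/-- The `k`-linear map `M ⊗ k[X] → M` which sends every `x : X` to `1`. -/
noncomputable def augment (k : Type) [CommRing k] (X : Type*) (M : Type*) [AddCommGroup M]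
    [Module k M] : M ⊗[k] MonoidAlgebra k X →ₗ[k] M :=
  (TensorProduct.rid k M).toLinearMap ∘ₗ
    ((MonoidAlgebra.basis X k).constr k fun _ => (1 : k)).lTensor M

@[simp]
theorem augment_tmul_single {X M : Type*} [AddCommGroup M] [Module k M] (m : M) (x : X) :
    augment k X M (m ⊗ₜ MonoidAlgebra.single x 1) = m := by
  have h := (MonoidAlgebra.basis X k).constr_basis k (fun _ => (1 : k)) x
  rw [MonoidAlgebra.basis_apply] at h
  simp only [augment, LinearMap.comp_apply, LinearMap.lTensor_tmul]
  erw [h]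
  simp

/-- Linear maps out of `M ⊗ k[X]` agree if they agree on all `m ⊗ x`. -/
theorem tensor_single_ext {X M N : Type*} [AddCommGroup M] [Module k M] [AddCommGroup N]
    [Module k N] {f g : M ⊗[k] MonoidAlgebra k X →ₗ[k] N}
    (h : ∀ m x, f (m ⊗ₜ MonoidAlgebra.single x 1) = g (m ⊗ₜ MonoidAlgebra.single x 1)) :
    f = g := by
  refine TensorProduct.ext' fun m a => ?_
  have : (TensorProduct.mk k M _).compr₂ f m = (TensorProduct.mk k M _).compr₂ g m :=
    (MonoidAlgebra.basis X k).ext fun x => by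
      rw [MonoidAlgebra.basis_apply]; exact h m x
  exact LinearMap.congr_fun this a

theorem augment_naturality {X M N : Type*} [AddCommGroup M] [Module k M] [AddCommGroup N]
    [Module k N] (f : M →ₗ[k] N) (a : M ⊗[k] MonoidAlgebra k X) :
    augment k X N (f.rTensor _ a) = f (augment k X M a) := by
  have : augment k X N ∘ₗ f.rTensor _ = f ∘ₗ augment k X M := tensor_single_ext fun m x => by simp
  exact LinearMap.congr_fun this a

/-- The linear map `M ⊗ k[X] → N` given by a family of linear maps `M → N` indexed by `X`. -/
noncomputable def ofFamily {X M N : Type*} [AddCommGroup M] [Module k M] [AddCommGroup N]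
    [Module k N] (σ : X → M →ₗ[k] N) : M ⊗[k] MonoidAlgebra k X →ₗ[k] N :=
  TensorProduct.lift ((MonoidAlgebra.basis X k).constr k σ).flip

@[simp]
theorem ofFamily_tmul_single {X M N : Type*} [AddCommGroup M] [Module k M] [AddCommGroup N]
    [Module k N] (σ : X → M →ₗ[k] N) (m : M) (x : X) :
    ofFamily σ (m ⊗ₜ MonoidAlgebra.single x 1) = σ x m := by
  have h := (MonoidAlgebra.basis X k).constr_basis k σ x
  rw [MonoidAlgebra.basis_apply] at h
  simp only [ofFamily, TensorProduct.lift.tmul, LinearMap.flip_apply]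
  exact LinearMap.congr_fun h m

/-- A family of linear maps indexed by a `G`-set is equivariant if it is a fixed point of the
conjugation action. -/
def EquivariantFamily {X : Type*} [MulAction G X] {M N : Type*} [AddCommGroup M] [Module k M]
    [AddCommGroup N] [Module k N] (ρ : Representation k G M) (τ : Representation k G N)
    (σ : X → M →ₗ[k] N) : Prop :=
  ∀ g x m, σ (g • x) (ρ g m) = τ g (σ x m)

theorem augment_equivariant {X : Type*} [MulAction G X] {M : Type*} [AddCommGroup M] [Module k M]
    (ρ : Representation k G M) (g : G) (a : M ⊗[k] MonoidAlgebra k X) :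
    augment k X M (ρ.tprod (Representation.ofMulAction k G X) g a) = ρ g (augment k X M a) := by
  have : augment k X M ∘ₗ (ρ.tprod (Representation.ofMulAction k G X) g) = ρ g ∘ₗ augment k X M :=
    tensor_single_ext fun m x => by simp [Representation.ofMulAction_single]
  exact LinearMap.congr_fun this a

theorem ofFamily_equivariant {X : Type*} [MulAction G X] {M N : Type*} [AddCommGroup M]
    [Module k M] [AddCommGroup N] [Module k N] {ρ : Representation k G M}
    {τ : Representation k G N} {σ : X → M →ₗ[k] N} (h : EquivariantFamily ρ τ σ)
    (g : G) (a : M ⊗[k] MonoidAlgebra k X) :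
    ofFamily σ (ρ.tprod (Representation.ofMulAction k G X) g a) = τ g (ofFamily σ a) := by
  have : ofFamily σ ∘ₗ (ρ.tprod (Representation.ofMulAction k G X) g) = τ g ∘ₗ ofFamily σ :=
    tensor_single_ext fun m x => by simp [Representation.ofMulAction_single, h g x m]
  exact LinearMap.congr_fun this a

/-- The family of linear maps `A → B`, indexed by the cosets of finite subgroups, of a morphism
`A ⊗ kΔ → B ⊗ kΔ`. -/
noncomputable def family {A B : Rep.{u} k G}
    (f : (tensorPerm k G).obj A ⟶ (tensorPerm k G).obj B) (x : FiniteCosets G) : A →ₗ[k] B :=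
  augment k (FiniteCosets G) B ∘ₗ f.hom.toLinearMap ∘ₗ
    (TensorProduct.mk k A (MonoidAlgebra k (FiniteCosets G))).flip (MonoidAlgebra.single x 1)

theorem family_apply {A B : Rep.{u} k G}
    (f : (tensorPerm k G).obj A ⟶ (tensorPerm k G).obj B) (x : FiniteCosets G) (a : A) :
    family f x a = augment k (FiniteCosets G) B (f.hom (a ⊗ₜ[k] MonoidAlgebra.single x 1)) :=
  rfl

theorem family_equivariant {A B : Rep.{u} k G}
    (f : (tensorPerm k G).obj A ⟶ (tensorPerm k G).obj B) :
    EquivariantFamily A.ρ B.ρ (family f) := by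
  intro g x a
  have h1 : (A.ρ g a) ⊗ₜ[k] MonoidAlgebra.single (g • x) (1 : k) =
      (A.ρ.tprod (permRep k G)) g (a ⊗ₜ[k] MonoidAlgebra.single x 1) := by
    simp [Representation.ofMulAction_single]
  have h2 : f.hom ((A.ρ.tprod (permRep k G)) g (a ⊗ₜ[k] MonoidAlgebra.single x 1)) =
      (B.ρ.tprod (permRep k G)) g (f.hom (a ⊗ₜ[k] MonoidAlgebra.single x 1)) :=
    Rep.hom_comm_apply f g _
  rw [family_apply, h1, family_apply]
  exact (congrArg _ h2).trans (augment_equivariant B.ρ g _)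

theorem family_id (A : Rep.{u} k G) (x : FiniteCosets G) (a : A) :
    family (𝟙 ((tensorPerm k G).obj A)) x a = a :=
  augment_tmul_single a x

theorem family_add {A B : Rep.{u} k G}
    (f g : (tensorPerm k G).obj A ⟶ (tensorPerm k G).obj B) (x : FiniteCosets G) (a : A) :
    family (f + g) x a = family f x a + family g x a :=
  map_add (augment k (FiniteCosets G) B) _ _

/-- `family` does not respect arbitrary composition, because a morphism may move the coset. It does
when one factor is the image of a morphism under `tensorPerm`, and the identities of a contracting
homotopy involve only such composites. -/
theorem family_comp_map {A B C : Rep.{u} k G}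
    (f : (tensorPerm k G).obj A ⟶ (tensorPerm k G).obj B) (g : B ⟶ C) (x : FiniteCosets G)
    (a : A) : family (f ≫ (tensorPerm k G).map g) x a = g.hom (family f x a) :=
  augment_naturality g.hom.toLinearMap _

theorem family_map_comp {A B C : Rep.{u} k G} (g : A ⟶ B)
    (f : (tensorPerm k G).obj B ⟶ (tensorPerm k G).obj C) (x : FiniteCosets G)
    (a : A) : family ((tensorPerm k G).map g ≫ f) x a = family f x (g.hom a) :=
  rfl

/-- The morphism `A ⊗ kΔ → B ⊗ kΔ`, `a ⊗ x ↦ σ x a ⊗ x`, of an equivariant family `σ`. -/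
noncomputable def homOfFamily {A B : Rep.{u} k G} (σ : FiniteCosets G → A →ₗ[k] B)
    (h : EquivariantFamily A.ρ B.ρ σ) :
    (tensorPerm k G).obj A ⟶ (tensorPerm k G).obj B :=
  Rep.ofHom
    { toLinearMap := ofFamily fun x =>
        (TensorProduct.mk k B (MonoidAlgebra k (FiniteCosets G))).flip
          (MonoidAlgebra.single x 1) ∘ₗ σ x
      isIntertwining' := fun g => LinearMap.ext fun a => ofFamily_equivariant
        (ρ := A.ρ) (τ := B.ρ.tprod (permRep k G)) (fun g x m => by
          simp [Representation.ofMulAction_single, h g x m]) g a }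

theorem homOfFamily_tmul_single {A B : Rep.{u} k G} (σ : FiniteCosets G → A →ₗ[k] B)
    (h : EquivariantFamily A.ρ B.ρ σ) (a : A) (x : FiniteCosets G) :
    (homOfFamily σ h).hom (a ⊗ₜ[k] MonoidAlgebra.single x 1) =
      σ x a ⊗ₜ[k] MonoidAlgebra.single x 1 :=
  ofFamily_tmul_single _ _ _

theorem tensorPerm_hom_ext {A B : Rep.{u} k G}
    {f g : (tensorPerm k G).obj A ⟶ (tensorPerm k G).obj B}
    (h : ∀ (a : A) (x : FiniteCosets G), f.hom (a ⊗ₜ[k] MonoidAlgebra.single x 1) =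
      g.hom (a ⊗ₜ[k] MonoidAlgebra.single x 1)) : f = g := by
  apply Rep.hom_ext
  apply Representation.IntertwiningMap.toLinearMap_injective
  exact tensor_single_ext h

/-- A module `A` is `𝔉`-projective if and only if the augmentation `A ⊗ kΔ → A` has a
`kG`-linear section. -/
theorem isFProjective_iff (A : Rep.{u} k G) : IsFProjective A ↔
    ∃ σ : A →ₗ[k] A ⊗[k] MonoidAlgebra k (FiniteCosets G),
      (∀ g a, σ (A.ρ g a) = A.ρ.tprod (permRep k G) g (σ a)) ∧
      ∀ a, augment k (FiniteCosets G) A (σ a) = a := by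
  constructor
  · rintro ⟨N, ⟨R⟩⟩
    -- The diagonal `n ⊗ x ↦ (n ⊗ x) ⊗ x` splits the augmentation for `N ⊗ kΔ`; naturality of the
    -- augmentation then carries the section over to the retract `A`.
    let δ : N ⊗[k] MonoidAlgebra k (FiniteCosets G) →ₗ[k]
        (N ⊗[k] MonoidAlgebra k (FiniteCosets G)) ⊗[k] MonoidAlgebra k (FiniteCosets G) :=
      ofFamily fun x => (TensorProduct.mk k _ _).flip (MonoidAlgebra.single x 1) ∘ₗ
        (TensorProduct.mk k _ _).flip (MonoidAlgebra.single x 1)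
    have hδ : ∀ g a, δ (N.ρ.tprod (permRep k G) g a) =
        (N.ρ.tprod (permRep k G)).tprod (permRep k G) g (δ a) := fun g a =>
      ofFamily_equivariant (ρ := N.ρ) (τ := (N.ρ.tprod (permRep k G)).tprod (permRep k G))
        (fun g x m => by simp [Representation.ofMulAction_single]) g a
    have hδ' : ∀ a, augment k (FiniteCosets G) _ (δ a) = a := fun a => by
      have : augment k (FiniteCosets G) _ ∘ₗ δ = LinearMap.id :=
        tensor_single_ext fun m x => by simp [δ]
      exact LinearMap.congr_fun this a
    let r : N ⊗[k] MonoidAlgebra k (FiniteCosets G) →ₗ[k] A := R.r.hom.toLinearMap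
    have hr : ∀ g a, r (N.ρ.tprod (permRep k G) g a) = A.ρ g (r a) := fun g a =>
      Rep.hom_comm_apply R.r g a
    let i : A →ₗ[k] N ⊗[k] MonoidAlgebra k (FiniteCosets G) := R.i.hom.toLinearMap
    refine ⟨r.rTensor _ ∘ₗ δ ∘ₗ i, fun g a => ?_, fun a => ?_⟩
    · have h1 : i (A.ρ g a) = N.ρ.tprod (permRep k G) g (i a) :=
        Rep.hom_comm_apply R.i g a
      have h2 : ∀ b, r.rTensor _ ((N.ρ.tprod (permRep k G)).tprod (permRep k G) g b) =
          A.ρ.tprod (permRep k G) g (r.rTensor _ b) := fun b => by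
        induction b with
        | zero => simp
        | add x y hx hy => rw [map_add, map_add, hx, hy, map_add, map_add]
        | tmul x y =>
          rw [Representation.tprod_apply, TensorProduct.map_tmul, LinearMap.rTensor_tmul, hr]
          rfl
      simp only [LinearMap.comp_apply]
      rw [h1, hδ, h2]
    · simp only [LinearMap.comp_apply]
      rw [augment_naturality, hδ']
      exact congrArg (fun f => f.hom a) R.retract
  · rintro ⟨σ, hσ, h⟩
    -- The module `N` can be taken to be `A` itself, with the augmentation as retraction.
    exact ⟨A, ⟨{
      i := Rep.ofHom ⟨σ, fun g => LinearMap.ext fun a => hσ g a⟩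
      r := Rep.ofHom ⟨augment k (FiniteCosets G) A, fun g =>
        LinearMap.ext fun a => augment_equivariant A.ρ g a⟩
      retract := by
        apply Rep.hom_ext
        apply Representation.IntertwiningMap.toLinearMap_injective
        exact LinearMap.ext h }⟩⟩

end Families

/-! ### Total complex of a tensor product and its contraction -/

section Total

variable {k : Type*} [CommRing k]

/-- A contraction of an augmented chain complex `⋯ → P 1 → P 0 → M → 0` of `k`-modules. -/
structure Contraction {P : ℕ → Type*} {M : Type*} [∀ i, AddCommGroup (P i)]
    [∀ i, Module k (P i)] [AddCommGroup M] [Module k M] (d : ∀ i, P (i + 1) →ₗ[k] P i)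
    (ε : P 0 →ₗ[k] M) where
  /-- The section of the augmentation. -/
  t : M →ₗ[k] P 0
  /-- The homotopy. -/
  s : ∀ i, P i →ₗ[k] P (i + 1)
  ε_t : ∀ m, ε (t m) = m
  t_ε : ∀ x, t (ε x) + d 0 (s 0 x) = x
  s_d : ∀ i x, s i (d i x) + d (i + 1) (s (i + 1) x) = x

section Contraction

variable {P : ℕ → Type*} {M : Type*} [∀ i, AddCommGroup (P i)]
  [∀ i, Module k (P i)] [AddCommGroup M] [Module k M] {d : ∀ i, P (i + 1) →ₗ[k] P i}
  {ε : P 0 →ₗ[k] M}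

theorem Contraction.surjective (c : Contraction d ε) : Function.Surjective ε :=
  fun m => ⟨c.t m, c.ε_t m⟩

theorem Contraction.exact_zero (c : Contraction d ε) (h : ∀ x, ε (d 0 x) = 0) :
    Function.Exact (d 0) ε := by
  refine fun x => ⟨fun hx => ⟨c.s 0 x, ?_⟩, ?_⟩
  · simpa [hx] using c.t_ε x
  · rintro ⟨y, rfl⟩
    exact h y

theorem Contraction.exact_succ (c : Contraction d ε) (h : ∀ i x, d i (d (i + 1) x) = 0) (i : ℕ) :
    Function.Exact (d (i + 1)) (d i) := by
  refine fun x => ⟨fun hx => ⟨c.s (i + 1) x, ?_⟩, ?_⟩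
  · simpa [hx] using c.s_d i x
  · rintro ⟨y, rfl⟩
    exact h i y

end Contraction

variable (k) in
/-- The degree `n` part of the total complex of the tensor product of two complexes. -/
abbrev Total (P : ℕ → Type v) (Q : ℕ → Type w) [∀ i, AddCommGroup (P i)] [∀ i, Module k (P i)]
    [∀ i, AddCommGroup (Q i)] [∀ i, Module k (Q i)] (n : ℕ) : Type (max v w) :=
  DirectSum {p : ℕ × ℕ // p.1 + p.2 = n} fun p => P p.1.1 ⊗[k] Q p.1.2

variable {P : ℕ → Type v} {Q : ℕ → Type w} [∀ i, AddCommGroup (P i)] [∀ i, Module k (P i)]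
  [∀ i, AddCommGroup (Q i)] [∀ i, Module k (Q i)]
  {M N L : Type*} [AddCommGroup M] [Module k M] [AddCommGroup N] [Module k N]
  [AddCommMonoid L] [Module k L]

/-- The inclusion of a summand in the total complex. -/
def totalι (i j : ℕ) {n : ℕ} (h : i + j = n) : P i ⊗[k] Q j →ₗ[k] Total k P Q n :=
  DirectSum.lof k {p : ℕ × ℕ // p.1 + p.2 = n} (fun p => P p.1.1 ⊗[k] Q p.1.2) ⟨(i, j), h⟩

/-- The linear map out of the total complex given by linear maps on the summands. -/
def totalDesc {n : ℕ} (f : ∀ i j, i + j = n → P i ⊗[k] Q j →ₗ[k] L) : Total k P Q n →ₗ[k] L :=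
  DirectSum.toModule k _ L fun p => f p.1.1 p.1.2 p.2

@[simp]
theorem totalDesc_ι {n : ℕ} (f : ∀ i j, i + j = n → P i ⊗[k] Q j →ₗ[k] L) (i j : ℕ)
    (h : i + j = n) (x : P i ⊗[k] Q j) : totalDesc f (totalι i j h x) = f i j h x :=
  DirectSum.toModule_lof k (M := fun p : {p : ℕ × ℕ // p.1 + p.2 = n} => P p.1.1 ⊗[k] Q p.1.2)
    ⟨(i, j), h⟩ x

theorem total_hom_ext {n : ℕ} {f g : Total k P Q n →ₗ[k] L}
    (h : ∀ i j (e : i + j = n) (x : P i) (y : Q j),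
      f (totalι i j e (x ⊗ₜ y)) = g (totalι i j e (x ⊗ₜ y))) : f = g := by
  refine DirectSum.linearMap_ext k fun p => TensorProduct.ext' fun x y => ?_
  exact h p.1.1 p.1.2 p.2 x y

variable (dP : ∀ i, P (i + 1) →ₗ[k] P i) (dQ : ∀ i, Q (i + 1) →ₗ[k] Q i)
  (εP : P 0 →ₗ[k] M) (εQ : Q 0 →ₗ[k] N)

/-- The differential of the total complex. -/
def totalD (n : ℕ) : Total k P Q (n + 1) →ₗ[k] Total k P Q n :=
  totalDesc fun i j h => match i, j, h with
    -- This case never occurs, since the bidegree has sum `n + 1`.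
    | 0, 0, _ => 0
    | i + 1, 0, h => totalι i 0 (by omega) ∘ₗ (dP i).rTensor (Q 0)
    | 0, j + 1, h => totalι 0 j (by omega) ∘ₗ (dQ j).lTensor (P 0)
    | i + 1, j + 1, h => totalι i (j + 1) (by omega) ∘ₗ (dP i).rTensor (Q (j + 1)) +
        (-1 : k) ^ (i + 1) • totalι (i + 1) j (by omega) ∘ₗ (dQ j).lTensor (P (i + 1))

theorem totalD_succ_zero {n : ℕ} (i : ℕ) (h : i + 1 + 0 = n + 1) (x : P (i + 1)) (y : Q 0) :
    totalD dP dQ n (totalι (i + 1) 0 h (x ⊗ₜ y)) = totalι i 0 (by omega) (dP i x ⊗ₜ y) := by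
  simp [totalD]

theorem totalD_zero_succ {n : ℕ} (j : ℕ) (h : 0 + (j + 1) = n + 1) (x : P 0) (y : Q (j + 1)) :
    totalD dP dQ n (totalι 0 (j + 1) h (x ⊗ₜ y)) = totalι 0 j (by omega) (x ⊗ₜ dQ j y) := by
  simp [totalD]

theorem totalD_succ_succ {n : ℕ} (i j : ℕ) (h : i + 1 + (j + 1) = n + 1) (x : P (i + 1))
    (y : Q (j + 1)) :
    totalD dP dQ n (totalι (i + 1) (j + 1) h (x ⊗ₜ y)) =
      totalι i (j + 1) (by omega) (dP i x ⊗ₜ y) +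
        (-1 : k) ^ (i + 1) • totalι (i + 1) j (by omega) (x ⊗ₜ dQ j y) := by
  simp [totalD]

/-- The augmentation of the total complex. -/
def totalε : Total k P Q 0 →ₗ[k] M ⊗[k] N :=
  totalDesc fun i j h => match i, j, h with
    | 0, 0, _ => TensorProduct.map εP εQ
    | _ + 1, _, _ => 0
    | 0, _ + 1, _ => 0

theorem totalε_zero (x : P 0) (y : Q 0) :
    totalε εP εQ (totalι 0 0 rfl (x ⊗ₜ y)) = εP x ⊗ₜ εQ y := by
  simp [totalε]

variable {dP dQ εP εQ}

theorem totalε_totalD (hP : ∀ x, εP (dP 0 x) = 0) (hQ : ∀ x, εQ (dQ 0 x) = 0)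
    (x : Total k P Q 1) : totalε εP εQ (totalD dP dQ 0 x) = 0 := by
  have : totalε εP εQ ∘ₗ totalD dP dQ 0 = 0 := by
    refine total_hom_ext fun i j e x y => ?_
    match i, j, e with
    | 0, 1, _ => simp [totalD_zero_succ, totalε_zero, hQ]
    | 1, 0, _ => simp [totalD_succ_zero, totalε_zero, hP]
    | i + 1, j + 1, e => omega
    | i + 2, 0, e => omega
    | 0, j + 2, e => omega
  exact LinearMap.congr_fun this x

theorem totalD_totalD (hP : ∀ i x, dP i (dP (i + 1) x) = 0) (hQ : ∀ i x, dQ i (dQ (i + 1) x) = 0)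
    (n : ℕ) (x : Total k P Q (n + 2)) : totalD dP dQ n (totalD dP dQ (n + 1) x) = 0 := by
  have : totalD dP dQ n ∘ₗ totalD dP dQ (n + 1) = 0 := by
    refine total_hom_ext fun i j e x y => ?_
    match i, j, e with
    | 0, j + 2, _ => simp [totalD_zero_succ, hQ]
    | i + 2, 0, _ => simp [totalD_succ_zero, hP]
    | 1, 1, _ => simp [totalD_succ_zero, totalD_zero_succ, totalD_succ_succ]; module
    | 1, j + 2, _ => simp [totalD_zero_succ, totalD_succ_succ, hQ]; module
    | i + 2, 1, _ => simp [totalD_succ_zero, totalD_succ_succ, hP, pow_succ]; module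
    | i + 2, j + 2, _ => simp [totalD_succ_succ, hP, hQ, pow_succ]; module
  exact LinearMap.congr_fun this x

/-- The contracting homotopy of the total complex. -/
def totalS (cP : Contraction dP εP) (cQ : Contraction dQ εQ) (n : ℕ) :
    Total k P Q n →ₗ[k] Total k P Q (n + 1) :=
  -- This is `s ⊗ 1 + tε ⊗ s'`, with `tε` read as zero in positive degrees. The second term lives
  -- only in `P`-degree `0`, so it needs no sign.
  totalDesc fun i j h => match i, h with
    | i + 1, h => totalι (i + 2) j (by omega) ∘ₗ (cP.s (i + 1)).rTensor (Q j)
    | 0, h => totalι 1 j (by omega) ∘ₗ (cP.s 0).rTensor (Q j) +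
        totalι 0 (j + 1) (by omega) ∘ₗ TensorProduct.map (cP.t ∘ₗ εP) (cQ.s j)

theorem totalS_succ (cP : Contraction dP εP) (cQ : Contraction dQ εQ) {n : ℕ} (i j : ℕ)
    (h : i + 1 + j = n) (x : P (i + 1)) (y : Q j) :
    totalS cP cQ n (totalι (i + 1) j h (x ⊗ₜ y)) =
      totalι (i + 2) j (by omega) (cP.s (i + 1) x ⊗ₜ y) := by
  simp [totalS]

theorem totalS_zero (cP : Contraction dP εP) (cQ : Contraction dQ εQ) {n : ℕ} (j : ℕ)
    (h : 0 + j = n) (x : P 0) (y : Q j) :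
    totalS cP cQ n (totalι 0 j h (x ⊗ₜ y)) = totalι 1 j (by omega) (cP.s 0 x ⊗ₜ y) +
      totalι 0 (j + 1) (by omega) (cP.t (εP x) ⊗ₜ cQ.s j y) := by
  simp [totalS]

/-- The section of the augmentation of the total complex. -/
def totalT (cP : Contraction dP εP) (cQ : Contraction dQ εQ) :
    M ⊗[k] N →ₗ[k] Total k P Q 0 :=
  totalι 0 0 rfl ∘ₗ TensorProduct.map cP.t cQ.t

theorem totalT_tmul (cP : Contraction dP εP) (cQ : Contraction dQ εQ) (x : M) (y : N) :
    totalT cP cQ (x ⊗ₜ y) = totalι 0 0 rfl (cP.t x ⊗ₜ cQ.t y) := by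
  simp [totalT]

/-- The tensor product of two contractions. -/
def totalContraction (cP : Contraction dP εP) (cQ : Contraction dQ εQ)
    (hP : ∀ x, εP (dP 0 x) = 0) :
    Contraction (totalD dP dQ) (totalε εP εQ) where
  t := totalT cP cQ
  s := totalS cP cQ
  ε_t m := by
    have : totalε εP εQ ∘ₗ totalT cP cQ = LinearMap.id :=
      TensorProduct.ext' fun x y => by simp [totalT_tmul, totalε_zero, cP.ε_t, cQ.ε_t]
    exact LinearMap.congr_fun this m
  t_ε x := by
    have : totalT cP cQ ∘ₗ totalε εP εQ + totalD dP dQ 0 ∘ₗ totalS cP cQ 0 = LinearMap.id := by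
      refine total_hom_ext fun i j e x y => ?_
      match i, j, e with
      | i + 1, j, e => omega
      | 0, j + 1, e => omega
      | 0, 0, e =>
        have h1 := cP.t_ε x
        have h2 := cQ.t_ε y
        simp only [LinearMap.add_apply, LinearMap.comp_apply, totalε_zero, totalT_tmul,
          totalS_zero, map_add, totalD_succ_zero, totalD_zero_succ, LinearMap.id_apply]
        have h3 : totalι (k := k) 0 0 e (cP.t (εP x) ⊗ₜ y + dP 0 (cP.s 0 x) ⊗ₜ y) =
            totalι 0 0 e (x ⊗ₜ[k] y) := by
          rw [← TensorProduct.add_tmul, h1]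
        have h4 : cP.t (εP x) ⊗ₜ[k] y = cP.t (εP x) ⊗ₜ[k] (cQ.t (εQ y) + dQ 0 (cQ.s 0 y)) := by rw [h2]
        rw [← h3, h4, TensorProduct.tmul_add, map_add, map_add]
        module
    exact LinearMap.congr_fun this x
  s_d n x := by
    have : totalS cP cQ n ∘ₗ totalD dP dQ n + totalD dP dQ (n + 1) ∘ₗ totalS cP cQ (n + 1) =
        LinearMap.id := by
      refine total_hom_ext fun i j e x y => ?_
      match i, j, e with
      | 0, j + 1, e =>
        have h1 := cP.t_ε x
        have h2 := cQ.s_d j y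
        simp only [LinearMap.add_apply, LinearMap.comp_apply, totalS_zero, map_add,
          totalD_succ_succ, totalD_zero_succ, LinearMap.id_apply, zero_add, pow_one]
        -- First `x` is expanded as `t (ε x) + d (s x)`; then, only next to `t (ε x)`, `y` is
        -- expanded by the homotopy of `Q`. The terms `s x ⊗ d y` cancel by the sign in the
        -- differential.
        have h3 : totalι (k := k) 0 (j + 1) e (cP.t (εP x) ⊗ₜ y + dP 0 (cP.s 0 x) ⊗ₜ y) =
            totalι 0 (j + 1) e (x ⊗ₜ[k] y) := by
          rw [← TensorProduct.add_tmul, h1]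
        have h4 : cP.t (εP x) ⊗ₜ[k] y = cP.t (εP x) ⊗ₜ[k] (cQ.s j (dQ j y) + dQ (j + 1) (cQ.s (j + 1) y)) := by rw [h2]
        rw [← h3, h4, TensorProduct.tmul_add, map_add, map_add]
        module
      -- In `P`-degree `1` the differential reaches degree `0`, where the extra term `t (ε (d x)) ⊗
      -- s' y` appears; it vanishes because `ε d = 0`.
      | 1, 0, _ =>
        conv_rhs => rw [← cP.s_d 0 x]
        simp [totalS_succ, totalS_zero, totalD_succ_zero, hP, TensorProduct.add_tmul]
      | 1, j + 1, _ =>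
        conv_rhs => rw [← cP.s_d 0 x]
        simp [totalS_succ, totalS_zero, totalD_succ_succ, hP, TensorProduct.add_tmul]
        module
      | i + 2, 0, _ =>
        conv_rhs => rw [← cP.s_d (i + 1) x]
        simp [totalS_succ, totalD_succ_zero, TensorProduct.add_tmul]
      | i + 2, j + 1, _ =>
        conv_rhs => rw [← cP.s_d (i + 1) x]
        simp [totalS_succ, totalD_succ_succ, TensorProduct.add_tmul, pow_succ]
        module
    exact LinearMap.congr_fun this x

end Total

/-! ### Outer tensor products and equivariance of the total complex -/

section Outer

variable {k : Type} [CommRing k] {H K : Type*} [Group H] [Group K]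

/-- The outer tensor product of representations of `H` and `K`, a representation of `H × K`. -/
noncomputable def outer {A B : Type*} [AddCommGroup A] [Module k A] [AddCommGroup B] [Module k B]
    (ρ : Representation k H A) (τ : Representation k K B) :
    Representation k (H × K) (A ⊗[k] B) :=
  Representation.tprod (ρ.comp (MonoidHom.fst H K)) (τ.comp (MonoidHom.snd H K))

@[simp]
theorem outer_tmul {A B : Type*} [AddCommGroup A] [Module k A] [AddCommGroup B] [Module k B]
    (ρ : Representation k H A) (τ : Representation k K B) (g : H × K) (a : A) (b : B) :
    outer ρ τ g (a ⊗ₜ b) = ρ g.1 a ⊗ₜ τ g.2 b :=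
  rfl

variable {P : ℕ → Type v} {Q : ℕ → Type w} [∀ i, AddCommGroup (P i)] [∀ i, Module k (P i)]
  [∀ i, AddCommGroup (Q i)] [∀ i, Module k (Q i)]
  {M N : Type*} [AddCommGroup M] [Module k M] [AddCommGroup N] [Module k N]
  (ρP : ∀ i, Representation k H (P i)) (ρQ : ∀ i, Representation k K (Q i))
  (ρM : Representation k H M) (ρN : Representation k K N)

/-- The action of `H × K` on the total complex. -/
noncomputable def totalRep (n : ℕ) : Representation k (H × K) (Total k P Q n) :=
  Representation.directSum fun p : {p : ℕ × ℕ // p.1 + p.2 = n} => outer (ρP p.1.1) (ρQ p.1.2)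

@[simp]
theorem totalRep_ι {n : ℕ} (g : H × K) (i j : ℕ) (h : i + j = n) (x : P i ⊗[k] Q j) :
    totalRep ρP ρQ n g (totalι i j h x) = totalι i j h (outer (ρP i) (ρQ j) g x) :=
  DirectSum.lmap_lof (i := (⟨(i, j), h⟩ : {p : ℕ × ℕ // p.1 + p.2 = n}))
    (fun p => outer (ρP p.1.1) (ρQ p.1.2) g) x

variable {ρP ρQ ρM ρN} {dP : ∀ i, P (i + 1) →ₗ[k] P i} {dQ : ∀ i, Q (i + 1) →ₗ[k] Q i}
  {εP : P 0 →ₗ[k] M} {εQ : Q 0 →ₗ[k] N}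

theorem totalD_equivariant (hP : ∀ i g x, dP i (ρP (i + 1) g x) = ρP i g (dP i x))
    (hQ : ∀ i g x, dQ i (ρQ (i + 1) g x) = ρQ i g (dQ i x)) (n : ℕ) (g : H × K)
    (x : Total k P Q (n + 1)) :
    totalD dP dQ n (totalRep ρP ρQ (n + 1) g x) = totalRep ρP ρQ n g (totalD dP dQ n x) := by
  have : totalD dP dQ n ∘ₗ totalRep ρP ρQ (n + 1) g = totalRep ρP ρQ n g ∘ₗ totalD dP dQ n := by
    refine total_hom_ext fun i j e x y => ?_
    match i, j, e with
    | 0, 0, e => omega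
    | 0, j + 1, _ => simp [totalD_zero_succ, hQ]
    | i + 1, 0, _ => simp [totalD_succ_zero, hP]
    | i + 1, j + 1, _ => simp [totalD_succ_succ, hP, hQ]
  exact LinearMap.congr_fun this x

theorem totalε_equivariant (hP : ∀ g x, εP (ρP 0 g x) = ρM g (εP x))
    (hQ : ∀ g x, εQ (ρQ 0 g x) = ρN g (εQ x)) (g : H × K) (x : Total k P Q 0) :
    totalε εP εQ (totalRep ρP ρQ 0 g x) = outer ρM ρN g (totalε εP εQ x) := by
  have : totalε εP εQ ∘ₗ totalRep ρP ρQ 0 g = outer ρM ρN g ∘ₗ totalε εP εQ := by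
    refine total_hom_ext fun i j e x y => ?_
    match i, j, e with
    | i + 1, j, e => omega
    | 0, j + 1, e => omega
    | 0, 0, _ => simp [totalε_zero, hP, hQ]
  exact LinearMap.congr_fun this x

section Equivariance

variable {X Y Z : Type*} [MulAction H X] [MulAction K Y] [MulAction (H × K) Z]
  {cP : X → Contraction dP εP} {cQ : Y → Contraction dQ εQ} {φ : Z → X} {ψ : Z → Y}

theorem totalT_equivariant (hφ : ∀ (g : H × K) z, φ (g • z) = g.1 • φ z)
    (hψ : ∀ (g : H × K) z, ψ (g • z) = g.2 • ψ z)
    (hP : EquivariantFamily ρM (ρP 0) fun x => (cP x).t)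
    (hQ : EquivariantFamily ρN (ρQ 0) fun y => (cQ y).t) :
    EquivariantFamily (outer ρM ρN) (totalRep ρP ρQ 0)
      fun z => totalT (cP (φ z)) (cQ (ψ z)) := by
  intro g z x
  have : totalT (cP (φ (g • z))) (cQ (ψ (g • z))) ∘ₗ outer ρM ρN g =
      totalRep ρP ρQ 0 g ∘ₗ totalT (cP (φ z)) (cQ (ψ z)) :=
    TensorProduct.ext' fun x y => by
      have h1 := hP g.1 (φ z) x
      have h2 := hQ g.2 (ψ z) y
      simp only at h1 h2
      simp [totalT_tmul, hφ, hψ, h1, h2]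
  exact LinearMap.congr_fun this x

/-- The homotopy is built naturally from `s`, `t`, `ε` and `s'`, so conjugating it by `g` amounts to
conjugating the two contractions by the components of `g`. Equivariance of `φ` and `ψ` matches this
with the action on the index set. -/
theorem totalS_equivariant (hφ : ∀ (g : H × K) z, φ (g • z) = g.1 • φ z)
    (hψ : ∀ (g : H × K) z, ψ (g • z) = g.2 • ψ z)
    (hεP : ∀ g x, εP (ρP 0 g x) = ρM g (εP x))
    (htP : EquivariantFamily ρM (ρP 0) fun x => (cP x).t)
    (hsP : ∀ i, EquivariantFamily (ρP i) (ρP (i + 1)) fun x => (cP x).s i)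
    (hsQ : ∀ i, EquivariantFamily (ρQ i) (ρQ (i + 1)) fun y => (cQ y).s i) (n : ℕ) :
    EquivariantFamily (totalRep ρP ρQ n) (totalRep ρP ρQ (n + 1))
      fun z => totalS (cP (φ z)) (cQ (ψ z)) n := by
  intro g z x
  have : totalS (cP (φ (g • z))) (cQ (ψ (g • z))) n ∘ₗ totalRep ρP ρQ n g =
      totalRep ρP ρQ (n + 1) g ∘ₗ totalS (cP (φ z)) (cQ (ψ z)) n := by
    refine total_hom_ext fun i j e x y => ?_
    have h1 := hsP i g.1 (φ z) x
    have h2 := hsQ j g.2 (ψ z) y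
    simp only at h1 h2
    match i, e with
    | 0, _ =>
      have h3 := htP g.1 (φ z) (εP x)
      simp only at h3
      simp [totalS_zero, hφ, hψ, h1, h2, h3, hεP]
    | i + 1, _ => simp [totalS_succ, hφ, hψ, h1]
  exact LinearMap.congr_fun this x

end Equivariance

end Outer

/-! ### Merging two permutation factors into one -/

section Combine

variable {k : Type} [CommRing k] {X Y Z : Type*} {A B L : Type*} [AddCommGroup A] [Module k A]
  [AddCommGroup B] [Module k B] [AddCommGroup L] [Module k L]

variable (k A B) in
/-- The linear map `(A ⊗ k[X]) ⊗ (B ⊗ k[Y]) → (A ⊗ B) ⊗ k[Z]` induced by a map `X × Y → Z`. -/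
noncomputable def combine (φ : X → Y → Z) :
    (A ⊗[k] MonoidAlgebra k X) ⊗[k] (B ⊗[k] MonoidAlgebra k Y) →ₗ[k]
      (A ⊗[k] B) ⊗[k] MonoidAlgebra k Z :=
  TensorProduct.lift <| ofFamily (k := k) (X := X) (M := A)
    (N := B ⊗[k] MonoidAlgebra k Y →ₗ[k] (A ⊗[k] B) ⊗[k] MonoidAlgebra k Z) fun x =>
    LinearMap.flip <| ofFamily (k := k) (X := Y) (M := B)
      (N := A →ₗ[k] (A ⊗[k] B) ⊗[k] MonoidAlgebra k Z) fun y =>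
    ((TensorProduct.mk k A B).compr₂ ((TensorProduct.mk k (A ⊗[k] B) (MonoidAlgebra k Z)).flip
      (MonoidAlgebra.single (φ x y) 1))).flip

@[simp]
theorem combine_tmul (φ : X → Y → Z) (a : A) (b : B) (x : X) (y : Y) :
    combine k A B φ ((a ⊗ₜ MonoidAlgebra.single x 1) ⊗ₜ (b ⊗ₜ MonoidAlgebra.single y 1)) =
      (a ⊗ₜ b) ⊗ₜ MonoidAlgebra.single (φ x y) 1 := by
  simp [combine]

theorem tensor_single_ext₂
    {f g : (A ⊗[k] MonoidAlgebra k X) ⊗[k] (B ⊗[k] MonoidAlgebra k Y) →ₗ[k] L}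
    (h : ∀ a x b y,
      f ((a ⊗ₜ MonoidAlgebra.single x 1) ⊗ₜ (b ⊗ₜ MonoidAlgebra.single y 1)) =
        g ((a ⊗ₜ MonoidAlgebra.single x 1) ⊗ₜ (b ⊗ₜ MonoidAlgebra.single y 1))) : f = g := by
  refine TensorProduct.ext <| tensor_single_ext fun a x => tensor_single_ext fun b y => ?_
  exact h a x b y

/-- Together with `combine_equivariant`, this makes `combine` send a tensor product of sections of
the two augmentations to a section of the augmentation over `H × K`. -/
theorem augment_combine (φ : X → Y → Z)
    (z : (A ⊗[k] MonoidAlgebra k X) ⊗[k] (B ⊗[k] MonoidAlgebra k Y)) :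
    augment k Z (A ⊗[k] B) (combine k A B φ z) =
      TensorProduct.map (augment k X A) (augment k Y B) z := by
  have : augment k Z (A ⊗[k] B) ∘ₗ combine k A B φ =
      TensorProduct.map (augment k X A) (augment k Y B) :=
    tensor_single_ext₂ fun a x b y => by simp
  exact LinearMap.congr_fun this z

theorem combine_equivariant {H K : Type*} [Group H] [Group K] [MulAction H X] [MulAction K Y]
    [MulAction (H × K) Z] {φ : X → Y → Z}
    (hφ : ∀ (g : H × K) x y, φ (g.1 • x) (g.2 • y) = g • φ x y)
    (ρ : Representation k H A) (τ : Representation k K B) (g : H × K)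
    (z : (A ⊗[k] MonoidAlgebra k X) ⊗[k] (B ⊗[k] MonoidAlgebra k Y)) :
    combine k A B φ (outer (ρ.tprod (Representation.ofMulAction k H X))
        (τ.tprod (Representation.ofMulAction k K Y)) g z) =
      (outer ρ τ).tprod (Representation.ofMulAction k (H × K) Z) g (combine k A B φ z) := by
  have : combine k A B φ ∘ₗ (outer (ρ.tprod (Representation.ofMulAction k H X))
        (τ.tprod (Representation.ofMulAction k K Y)) g) =
      ((outer ρ τ).tprod (Representation.ofMulAction k (H × K) Z) g) ∘ₗ combine k A B φ :=
    tensor_single_ext₂ fun a x b y => by simp [Representation.ofMulAction_single, hφ]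
  exact LinearMap.congr_fun this z

end Combine

/-! ### Cosets of finite subgroups under homomorphisms and products -/

section FiniteCosets

variable {G : Type u} {G' : Type v} [Group G] [Group G']

/-- The image of a finite subgroup under a group homomorphism. -/
def mapFinite (f : G →* G') (F : {F : Subgroup G // Finite F}) : {F : Subgroup G' // Finite F} :=
  ⟨F.1.map f, have := F.2; inferInstanceAs (Finite (f '' (F.1 : Set G)))⟩

/-- The map on cosets of finite subgroups induced by a group homomorphism. -/
def mapCoset (f : G →* G') (x : FiniteCosets G) : FiniteCosets G' :=
  ⟨mapFinite f x.1,
    Quotient.map' f (fun a b h => by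
      have h1 : a⁻¹ * b ∈ x.1.1 := QuotientGroup.leftRel_apply.1 h
      have h2 : (f a)⁻¹ * f b ∈ (mapFinite f x.1).1 := ⟨a⁻¹ * b, h1, by simp⟩
      exact QuotientGroup.leftRel_apply.2 h2) x.2⟩

theorem mapCoset_smul (f : G →* G') (g : G) (x : FiniteCosets G) :
    mapCoset f (g • x) = f g • mapCoset f x := by
  obtain ⟨F, x⟩ := x
  induction x using Quotient.inductionOn' with
  | h a =>
    exact congrArg (fun c : G' => (⟨mapFinite f F, QuotientGroup.mk c⟩ : FiniteCosets G'))
      (map_mul f g a)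

/-- The coset of `F₁ × F₂` given by cosets of `F₁` and `F₂`. -/
def prodCoset (x : FiniteCosets G) (y : FiniteCosets G') : FiniteCosets (G × G') :=
  ⟨⟨x.1.1.prod y.1.1, have := x.1.2; have := y.1.2
      Finite.of_equiv _ (x.1.1.prodEquiv y.1.1).symm.toEquiv⟩,
    Quotient.map₂ (fun a b => (a, b)) (fun a a' h b b' h' => by
      have h1 : a⁻¹ * a' ∈ x.1.1 := QuotientGroup.leftRel_apply.1 h
      have h2 : b⁻¹ * b' ∈ y.1.1 := QuotientGroup.leftRel_apply.1 h'
      have h3 : (a, b)⁻¹ * (a', b') ∈ x.1.1.prod y.1.1 := Subgroup.mem_prod.2 ⟨h1, h2⟩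
      exact QuotientGroup.leftRel_apply.2 h3) x.2 y.2⟩

theorem prodCoset_smul (g : G × G') (x : FiniteCosets G) (y : FiniteCosets G') :
    prodCoset (g.1 • x) (g.2 • y) = g • prodCoset x y := by
  obtain ⟨F, x⟩ := x
  obtain ⟨F', y⟩ := y
  induction x using Quotient.inductionOn' with
  | h a =>
  induction y using Quotient.inductionOn' with
  | h b => rfl

end FiniteCosets

/-! ### 𝔉-projective resolutions as equivariantly contractible complexes -/

section Resolutions

variable {k : Type} [CommRing k] {G : Type u} [Group G]

/-- Taking `family` of the splitting maps turns each splitting identity into the corresponding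
identity for every coset separately. -/
theorem FProjResolution.exists_contraction {M : Rep.{u} k G} {n : ℕ} (r : FProjResolution M n) :
    ∃ c : FiniteCosets G →
        Contraction (fun i => (r.d i).hom.toLinearMap) r.ε.hom.toLinearMap,
      EquivariantFamily M.ρ (r.P 0).ρ (fun x => (c x).t) ∧
        ∀ i, EquivariantFamily (r.P i).ρ (r.P (i + 1)).ρ fun x => (c x).s i := by
  obtain ⟨t, s, h1, h2, h3⟩ := r.split
  refine ⟨fun x => ⟨family t x, fun i => family (s i) x, fun m => ?_, fun y => ?_, fun i y => ?_⟩,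
    family_equivariant t, fun i => family_equivariant (s i)⟩
  · exact (family_comp_map t r.ε x m).symm.trans (by rw [h1, family_id])
  · have := family_id (r.P 0) x y
    rwa [← h2, family_add, family_comp_map, family_map_comp] at this
  · have := family_id (r.P (i + 1)) x y
    rwa [← h3, family_add, family_comp_map, family_map_comp] at this

/-- An equivariant family of contractions gives an `𝔉`-projective resolution. -/
theorem FProjResolution.nonempty_of_contraction {M : Rep.{u} k G} {n : ℕ} (P : ℕ → Rep.{u} k G)
    (d : ∀ i, P (i + 1) ⟶ P i) (ε : P 0 ⟶ M) (hP : ∀ i, IsFProjective (P i))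
    (h0 : ∀ i, n < i → Limits.IsZero (P i)) (hε : ∀ x, ε.hom ((d 0).hom x) = 0)
    (hd : ∀ i x, (d i).hom ((d (i + 1)).hom x) = 0)
    (c : FiniteCosets G → Contraction (fun i => (d i).hom.toLinearMap) ε.hom.toLinearMap)
    (ht : EquivariantFamily M.ρ (P 0).ρ (fun x => (c x).t))
    (hs : ∀ i, EquivariantFamily (P i).ρ (P (i + 1)).ρ fun x => (c x).s i) :
    Nonempty (FProjResolution M n) := by
  -- Exactness needs just one contraction; the coset of the trivial subgroup shows that Δ is
  -- nonempty.
  let c₀ := c ⟨⟨⊥, inferInstance⟩, QuotientGroup.mk 1⟩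
  refine ⟨⟨P, d, ε, hP, h0, c₀.surjective, c₀.exact_zero hε, fun i => c₀.exact_succ hd i,
    homOfFamily _ ht, fun i => homOfFamily _ (hs i), ?_, ?_, fun i => ?_⟩⟩
  · refine tensorPerm_hom_ext fun a x => ?_
    have h1 := homOfFamily_tmul_single _ ht a x
    refine (congrArg ((tensorPerm k G).map ε).hom h1).trans ?_
    exact congrArg (· ⊗ₜ[k] _) ((c x).ε_t a)
  · refine tensorPerm_hom_ext fun a x => ?_
    have h1 := homOfFamily_tmul_single _ ht (ε.hom a) x
    have h2 := homOfFamily_tmul_single _ (hs 0) a x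
    have h3 := congrArg ((tensorPerm k G).map (d 0)).hom h2
    refine (congrArg₂ (· + ·) h1 h3).trans ?_
    refine (TensorProduct.add_tmul _ _ _).symm.trans ?_
    exact congrArg (· ⊗ₜ[k] _) ((c x).t_ε a)
  · refine tensorPerm_hom_ext fun a x => ?_
    have h1 := homOfFamily_tmul_single _ (hs i) ((d i).hom a) x
    have h2 := homOfFamily_tmul_single _ (hs (i + 1)) a x
    have h3 := congrArg ((tensorPerm k G).map (d (i + 1))).hom h2
    refine (congrArg₂ (· + ·) h1 h3).trans ?_
    refine (TensorProduct.add_tmul _ _ _).symm.trans ?_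
    exact congrArg (· ⊗ₜ[k] _) ((c x).s_d i a)

/-- Transport of a resolution along an isomorphism of the resolved modules. -/
noncomputable def FProjResolution.ofIso {M N : Rep.{u} k G} {n : ℕ} (r : FProjResolution M n)
    (e : M ≅ N) : FProjResolution N n where
  P := r.P
  d := r.d
  ε := r.ε ≫ e.hom
  isFProjective := r.isFProjective
  isZero := r.isZero
  surjective_ε y := by
    obtain ⟨x, hx⟩ := r.surjective_ε (e.inv.hom y)
    refine ⟨x, ?_⟩
    change e.hom.hom (r.ε.hom x) = y
    rw [hx, Rep.hom_inv_apply]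
  exact_zero x := by
    rw [← r.exact_zero x]
    change e.hom.hom (r.ε.hom x) = 0 ↔ _
    refine ⟨fun h => ?_, fun h => by rw [h, map_zero]⟩
    have h1 : e.inv.hom (e.hom.hom (r.ε.hom x)) = r.ε.hom x := by simp
    rw [← h1, h, map_zero]
  exact_succ := r.exact_succ
  split := by
    obtain ⟨t, s, h1, h2, h3⟩ := r.split
    refine ⟨(tensorPerm k G).map e.inv ≫ t, s, ?_, ?_, h3⟩
    · rw [Functor.map_comp, Category.assoc, reassoc_of% h1, ← Functor.map_comp, e.inv_hom_id,
        CategoryTheory.Functor.map_id]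
    · rw [← Functor.map_comp_assoc, Category.assoc, e.hom_inv_id, Category.comp_id, h2]

/-- Lengths are natural numbers: if every resolution is longer than `n`, the infimum is at least `n
+ 1`. So a finite bound is witnessed by an actual resolution. -/
theorem fpd_le_iff (M : Rep.{u} k G) (n : ℕ) :
    fpd M ≤ n ↔ ∃ m ≤ n, Nonempty (FProjResolution M m) := by
  constructor
  · intro h
    by_contra! hn
    have : ((n + 1 : ℕ) : ℕ∞) ≤ fpd M := by
      refine le_iInf₂ fun m hm => ?_
      have : n < m := by
        by_contra! hle
        exact (not_isEmpty_iff.2 hm) (hn m hle)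
      exact_mod_cast this
    have := this.trans h
    norm_cast at this
    omega
  · rintro ⟨m, hm, hr⟩
    exact (iInf₂_le m hr).trans (by exact_mod_cast hm)

theorem isZero_iff_subsingleton (A : Rep.{u} k G) : Limits.IsZero A ↔ Subsingleton A := by
  constructor
  · intro h
    refine ⟨fun x y => ?_⟩
    have h1 : ∀ z : A, z = 0 := fun z =>
      congrArg (fun f : A ⟶ A => f.hom z) (h.eq_of_src (𝟙 A) 0)
    rw [h1 x, h1 y]
  · intro h
    rw [Limits.IsZero.iff_id_eq_zero]
    apply Rep.hom_ext
    apply Representation.IntertwiningMap.toLinearMap_injective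
    exact LinearMap.ext fun x => Subsingleton.elim _ _

end Resolutions

/-! ### The resolution over a direct product -/

section Product

variable {k : Type} [CommRing k] {H : Type u} {K : Type v} [Group H] [Group K]

/-- On each summand `P i ⊗ Q j` the section is `σ i ⊗ τ j` followed by merging the cosets `aF` and
`bF'` into `(a, b)(F × F')`. It preserves the summands, so it assembles to the direct sum. -/
theorem isFProjective_total (P : ℕ → Rep.{u} k H) (Q : ℕ → Rep.{v} k K)
    (hP : ∀ i, IsFProjective (P i)) (hQ : ∀ i, IsFProjective (Q i)) (n : ℕ) :
    IsFProjective (Rep.of (totalRep (fun i => (P i).ρ) (fun i => (Q i).ρ) n)) := by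
  simp only [isFProjective_iff] at hP hQ ⊢
  choose σ hσ hσ' using hP
  choose τ hτ hτ' using hQ
  let Z := FiniteCosets (H × K)
  let Φ : Total k (fun i => P i) (fun i => Q i) n →ₗ[k]
      Total k (fun i => P i) (fun i => Q i) n ⊗[k] MonoidAlgebra k Z :=
    totalDesc (P := fun i => P i) (Q := fun i => Q i) fun i j h =>
      (totalι (P := fun i => P i) (Q := fun i => Q i) i j h).rTensor (MonoidAlgebra k Z) ∘ₗ
        combine k (P i) (Q j) prodCoset ∘ₗ TensorProduct.map (σ i) (τ j)
  refine ⟨Φ, fun g a => ?_, fun a => ?_⟩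
  · have : Φ ∘ₗ totalRep (fun i => (P i).ρ) (fun i => (Q i).ρ) n g =
        ((totalRep (fun i => (P i).ρ) (fun i => (Q i).ρ) n).tprod (permRep k (H × K)) g) ∘ₗ Φ := by
      refine total_hom_ext (P := fun i => P i) (Q := fun i => Q i) fun i j e x y => ?_
      have h1 : ∀ z : (P i ⊗[k] Q j) ⊗[k] MonoidAlgebra k Z,
          (totalι (P := fun i => P i) (Q := fun i => Q i) i j e).rTensor (MonoidAlgebra k Z)
            ((outer (P i).ρ (Q j).ρ).tprod (permRep k (H × K)) g z) =
          (totalRep (fun i => (P i).ρ) (fun i => (Q i).ρ) n).tprod (permRep k (H × K)) g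
            ((totalι (P := fun i => P i) (Q := fun i => Q i) i j e).rTensor
              (MonoidAlgebra k Z) z) := fun z => by
        induction z with
        | zero => simp
        | add x y hx hy => rw [map_add, map_add, hx, hy, map_add, map_add]
        | tmul x y => simp
      have h2 := combine_equivariant (k := k) prodCoset_smul (P i).ρ (Q j).ρ g (σ i x ⊗ₜ τ j y)
      simp only [Φ, LinearMap.comp_apply, totalRep_ι, totalDesc_ι]
      rw [outer_tmul, TensorProduct.map_tmul, TensorProduct.map_tmul, hσ, hτ, ← h1, ← h2]
      rfl
    exact LinearMap.congr_fun this a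
  · have : augment k Z (Total k (fun i => P i) (fun i => Q i) n) ∘ₗ Φ = LinearMap.id := by
      refine total_hom_ext (P := fun i => P i) (Q := fun i => Q i) fun i j e x y => ?_
      simp only [Φ, LinearMap.comp_apply, totalDesc_ι, augment_naturality, augment_combine,
        TensorProduct.map_tmul, LinearMap.id_apply]
      rw [hσ', hτ']
    exact LinearMap.congr_fun this a

theorem FProjResolution.nonempty_prod {M : Rep.{u} k H} {N : Rep.{v} k K} {n m : ℕ}
    (r : FProjResolution M n) (q : FProjResolution N m) :
    Nonempty (FProjResolution (Rep.of (outer M.ρ N.ρ)) (n + m)) := by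
  obtain ⟨c, ht, hs⟩ := r.exists_contraction
  obtain ⟨c', ht', hs'⟩ := q.exists_contraction
  have hε : ∀ x, r.ε.hom ((r.d 0).hom x) = 0 := r.exact_zero.apply_apply_eq_zero
  have hε' : ∀ x, q.ε.hom ((q.d 0).hom x) = 0 := q.exact_zero.apply_apply_eq_zero
  have hd : ∀ i x, (r.d i).hom ((r.d (i + 1)).hom x) = 0 :=
    fun i => (r.exact_succ i).apply_apply_eq_zero
  have hd' : ∀ i x, (q.d i).hom ((q.d (i + 1)).hom x) = 0 :=
    fun i => (q.exact_succ i).apply_apply_eq_zero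
  let ρP := fun i => (r.P i).ρ
  let ρQ := fun i => (q.P i).ρ
  -- Each coset in `H × K` selects the contractions of `P` and `Q` indexed by its two projections.
  let φ : FiniteCosets (H × K) → FiniteCosets H := mapCoset (MonoidHom.fst H K)
  let ψ : FiniteCosets (H × K) → FiniteCosets K := mapCoset (MonoidHom.snd H K)
  let dP := fun i => (r.d i).hom.toLinearMap
  let dQ := fun i => (q.d i).hom.toLinearMap
  let D : ∀ i, (totalRep ρP ρQ (i + 1)).IntertwiningMap (totalRep ρP ρQ i) := fun i =>
    ⟨totalD dP dQ i, fun g => LinearMap.ext <| totalD_equivariant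
      (fun i => Rep.hom_comm_apply (r.d i)) (fun i => Rep.hom_comm_apply (q.d i)) i g⟩
  let E : (totalRep ρP ρQ 0).IntertwiningMap (outer M.ρ N.ρ) :=
    ⟨totalε r.ε.hom.toLinearMap q.ε.hom.toLinearMap, fun g => LinearMap.ext <|
      totalε_equivariant (Rep.hom_comm_apply r.ε) (Rep.hom_comm_apply q.ε) g⟩
  have hED := totalε_totalD (P := fun i => r.P i) (Q := fun i => q.P i) (dP := dP) (dQ := dQ)
    hε hε'
  let C := fun z => totalContraction (P := fun i => r.P i) (Q := fun i => q.P i) (dP := dP)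
    (dQ := dQ) (c (φ z)) (c' (ψ z)) hε
  have hT := totalT_equivariant (P := fun i => r.P i) (Q := fun i => q.P i) (dP := dP) (dQ := dQ)
    (ρP := ρP) (ρQ := ρQ) (cP := c) (cQ := c') (φ := φ) (ψ := ψ)
    (mapCoset_smul _) (mapCoset_smul _) ht ht'
  have hS := totalS_equivariant (P := fun i => r.P i) (Q := fun i => q.P i) (dP := dP) (dQ := dQ)
    (ρP := ρP) (ρQ := ρQ) (cP := c) (cQ := c') (φ := φ) (ψ := ψ)
    (mapCoset_smul _) (mapCoset_smul _) (Rep.hom_comm_apply r.ε) ht hs hs'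
  have hDD := totalD_totalD (P := fun i => r.P i) (Q := fun i => q.P i) (dP := dP) (dQ := dQ)
    hd hd'
  refine FProjResolution.nonempty_of_contraction (fun i => Rep.of (totalRep ρP ρQ i))
    (fun i => Rep.ofHom (D i)) (Rep.ofHom E)
    (isFProjective_total r.P q.P r.isFProjective q.isFProjective) (fun i hi => ?_)
    hED hDD C hT hS
  rw [isZero_iff_subsingleton]
  -- If `a + b > n + m`, then `a > n` or `b > m`, so one tensor factor of each summand is zero.
  have h : ∀ p : {p : ℕ × ℕ // p.1 + p.2 = i}, Subsingleton (r.P p.1.1 ⊗[k] q.P p.1.2) := by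
    rintro ⟨⟨a, b⟩, hab⟩
    rcases lt_or_ge n a with ha | ha
    · have := (isZero_iff_subsingleton _).1 (r.isZero a ha)
      infer_instance
    · have := (isZero_iff_subsingleton _).1 (q.isZero b (by simp only at hab; omega))
      infer_instance
  exact inferInstanceAs (Subsingleton (DirectSum _ _))

/-- The outer tensor product of trivial modules is trivial. -/
noncomputable def outerTrivialIso (k : Type) [CommRing k] (H : Type u) (K : Type v) [Group H]
    [Group K] : Rep.of (outer (trivialRep k H).ρ (trivialRep k K).ρ) ≅ trivialRep k (H × K) :=
  Rep.mkIso <| Representation.Equiv.mk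
    ((TensorProduct.congr ULift.moduleEquiv ULift.moduleEquiv).trans
      ((TensorProduct.lid k k).trans ULift.moduleEquiv.symm))
    fun _ => TensorProduct.ext' fun _ _ => rfl

theorem fcd_prod_le (n m : ℕ) (hH : fcd H ≤ n) (hK : fcd K ≤ m) :
    fcd (H × K) ≤ ((n + m : ℕ) : ℕ∞) := by
  obtain ⟨a, ha, ⟨r⟩⟩ := (fpd_le_iff _ _).1 hH
  obtain ⟨b, hb, ⟨q⟩⟩ := (fpd_le_iff _ _).1 hK
  obtain ⟨s⟩ := r.nonempty_prod q
  exact (fpd_le_iff _ _).2 ⟨a + b, add_le_add ha hb, ⟨s.ofIso (outerTrivialIso ℤ H K)⟩⟩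

end Product

end FCoh

theorem mainTheorem10 (H : Type*) (K : Type*) [Group H] [Group K] (n m : ℕ)
    (hH : FCoh.fcd H ≤ (n : ℕ∞)) (hK : FCoh.fcd K ≤ (m : ℕ∞)) :
    FCoh.fcd (H × K) ≤ ((n + m : ℕ) : ℕ∞) :=
  FCoh.fcd_prod_le n m hH hK
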